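/- There is a universal constant $C>0$ such that the following holds. Let $(M,d)$ be a metric space with a distinguished point $0\in M$, and let $D>0$ be a real number such that every open ball of radius $R>0$ in $M$ can be covered by at most $D$ open balls of $M$ of radius $R/2$ (that is, $M$ is doubling with doubling constant $D(M)=D$). Let $\mathrm{Lip}_0(M)$ be the space of real-valued Lipschitz functions $f$ on $M$ with $f(0)=0$, normed by the Lipschitz constant $\|f\|=\sup_{x\ne y}|f(x)-f(y)|/d(x,y)$ (with $\|f\|=0$ if $M$ is a single point), and let $\mathcal F(M)$ be the Lipschitz-free space over $M$, i.e. the closed linear span in the dual space $\mathrm{Lip}_0(M)^*$ of the evaluation functionals $\delta(p)\colon g\mapsto g(p)$, $p\in M$. Then $\mathcal F(M)$ has the $\lambda$-bounded approximation property with $\lambda=C(1+\log D)$: one has $1\le\lambda<\infty$, and for every $\varepsilon>0$ and every compact set $K\subset\mathcal F(M)$ there is a bounded finite-rank linear operator $T\colon\mathcal F(M)\to\mathcal F(M)$ with $\|T\|\le\lambda$ and $\|T(x)-x\|\le\varepsilon$ for all $x\in K$. -/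

import Mathlib

open scoped NNReal

/-- The real-valued Lipschitz functions on the metric space `M` that vanish at the base point `o`,
as a linear subspace of all functions. -/
def lip0Submodule (M : Type*) [MetricSpace M] (o : M) : Submodule ℝ (M → ℝ) where
  carrier := {f | (∃ K : ℝ≥0, LipschitzWith K f) ∧ f o = 0}
  zero_mem' := ⟨⟨0, LipschitzWith.const 0⟩, rfl⟩
  add_mem' := by
    rintro f g ⟨⟨K, hK⟩, hf⟩ ⟨⟨L, hL⟩, hg⟩
    exact ⟨⟨K + L, hK.add hL⟩, by simp [hf, hg]⟩
  smul_mem' := by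
    rintro c f ⟨⟨K, hK⟩, hf⟩
    refine ⟨⟨‖c‖₊ * K, LipschitzWith.of_dist_le_mul fun x y => ?_⟩, by simp [hf]⟩
    have h := hK.dist_le_mul x y
    simp only [Pi.smul_apply, smul_eq_mul, Real.dist_eq, ← mul_sub, abs_mul] at h ⊢
    push_cast
    rw [Real.norm_eq_abs, mul_assoc]
    exact mul_le_mul_of_nonneg_left h (abs_nonneg c)

/-- The space `Lip₀(M)` of the pointed metric space `(M, o)`. It is a type of its own, so that it
carries the Lipschitz norm and nothing inherited from `M → ℝ`. -/
def Lip0 (M : Type*) [MetricSpace M] (o : M) : Type _ := lip0Submodule M o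

namespace Lip0

variable {M : Type*} [MetricSpace M] {o : M}

noncomputable instance : AddCommGroup (Lip0 M o) := inferInstanceAs (AddCommGroup (lip0Submodule M o))

noncomputable instance : Module ℝ (Lip0 M o) := inferInstanceAs (Module ℝ (lip0Submodule M o))

instance : CoeFun (Lip0 M o) (fun _ => M → ℝ) := ⟨fun f => f.1⟩

theorem add_apply (f g : Lip0 M o) (x : M) : (f + g) x = f x + g x := rfl

theorem neg_apply (f : Lip0 M o) (x : M) : (-f) x = -f x := rfl

theorem smul_apply (c : ℝ) (f : Lip0 M o) (x : M) : (c • f) x = c * f x := rfl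

theorem zero_apply (x : M) : (0 : Lip0 M o) x = 0 := rfl

theorem ext {f g : Lip0 M o} (h : ∀ x, f x = g x) : f = g := Subtype.ext (funext h)

theorem apply_base (f : Lip0 M o) : f o = 0 := f.2.2

/-- The difference quotients `|f x - f y| / d(x, y)`, `x ≠ y`. -/
def slopes (f : M → ℝ) : Set ℝ := {r | ∃ x y : M, x ≠ y ∧ r = |f x - f y| / dist x y}

/-- `‖f‖ = Lip(f)`, the supremum of the difference quotients (`0` for a one-point space). -/
noncomputable instance : Norm (Lip0 M o) := ⟨fun f => sSup (slopes f)⟩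

theorem norm_def (f : Lip0 M o) : ‖f‖ = sSup (slopes f) := rfl

theorem bddAbove_slopes (f : Lip0 M o) : BddAbove (slopes f) := by
  obtain ⟨K, hK⟩ := f.2.1
  refine ⟨K, ?_⟩
  rintro r ⟨x, y, hxy, rfl⟩
  rw [div_le_iff₀ (dist_pos.2 hxy), ← Real.dist_eq]
  exact hK.dist_le_mul x y

theorem norm_nonneg' (f : Lip0 M o) : 0 ≤ ‖f‖ := by
  apply Real.sSup_nonneg
  rintro r ⟨x, y, -, rfl⟩
  positivity

theorem abs_sub_le (f : Lip0 M o) (x y : M) : |f x - f y| ≤ ‖f‖ * dist x y := by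
  rcases eq_or_ne x y with rfl | hxy
  · simp
  · rw [← div_le_iff₀ (dist_pos.2 hxy)]
    exact le_csSup (bddAbove_slopes f) ⟨x, y, hxy, rfl⟩

theorem norm_le_of {f : Lip0 M o} {c : ℝ} (hc : 0 ≤ c)
    (h : ∀ x y, |f x - f y| ≤ c * dist x y) : ‖f‖ ≤ c := by
  refine Real.sSup_le ?_ hc
  rintro r ⟨x, y, hxy, rfl⟩
  rw [div_le_iff₀ (dist_pos.2 hxy)]
  exact h x y

theorem abs_apply_le (f : Lip0 M o) (x : M) : |f x| ≤ ‖f‖ * dist x o := by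
  simpa [apply_base] using abs_sub_le f x o

theorem norm_smul_le' (c : ℝ) (f : Lip0 M o) : ‖c • f‖ ≤ |c| * ‖f‖ := by
  refine norm_le_of (mul_nonneg (abs_nonneg c) (norm_nonneg' f)) fun x y => ?_
  rw [smul_apply, smul_apply, ← mul_sub, abs_mul, mul_assoc]
  exact mul_le_mul_of_nonneg_left (abs_sub_le f x y) (abs_nonneg c)

noncomputable instance : NormedAddCommGroup (Lip0 M o) :=
  AddGroupNorm.toNormedAddCommGroup
    { toFun := fun f => ‖f‖
      map_zero' := le_antisymm
        (norm_le_of le_rfl fun x y => by simp [zero_apply]) (norm_nonneg' _)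
      add_le' := fun f g => by
        refine norm_le_of (add_nonneg (norm_nonneg' f) (norm_nonneg' g)) fun x y => ?_
        have e : (f + g) x - (f + g) y = (f x - f y) + (g x - g y) := by
          rw [add_apply, add_apply]; ring
        rw [e, add_mul]
        exact (abs_add_le _ _).trans (add_le_add (abs_sub_le f x y) (abs_sub_le g x y))
      neg' := fun f => by
        have key : ∀ g : Lip0 M o, ‖-g‖ ≤ ‖g‖ := fun g => by
          simpa using norm_smul_le' (-1) g
        exact le_antisymm (key f) (by simpa using key (-f))
      eq_zero_of_map_eq_zero' := fun f hf => by
        refine ext fun x => ?_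
        have h := abs_apply_le f x
        rw [show ‖f‖ = 0 from hf, zero_mul] at h
        exact abs_nonpos_iff.1 h }

noncomputable instance : NormedSpace ℝ (Lip0 M o) where
  norm_smul_le c f := norm_smul_le' c f

/-- The Dirac map `δ : M → Lip₀(M)*`, `⟨g, δ(p)⟩ = g(p)`. -/
noncomputable def dirac (o : M) (p : M) : StrongDual ℝ (Lip0 M o) :=
  LinearMap.mkContinuous
    { toFun := fun g => g p
      map_add' := fun f g => add_apply f g p
      map_smul' := fun c f => smul_apply c f p }
    (dist p o) (fun g => by
      rw [mul_comm]
      exact abs_apply_le g p)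

end Lip0

/-- The Lipschitz-free space `F(M)` of the pointed metric space `(M, o)`: the closed linear span
of the evaluation functionals in the Banach space dual of `Lip₀(M)`, with the dual norm. -/
noncomputable def LipschitzFree (M : Type*) [MetricSpace M] (o : M) :
    Submodule ℝ (StrongDual ℝ (Lip0 M o)) :=
  (Submodule.span ℝ (Set.range (Lip0.dirac o))).topologicalClosure

instance (M : Type*) [MetricSpace M] (o : M) : CompleteSpace (LipschitzFree M o) :=
  (Submodule.isClosed_topologicalClosure _).completeSpace_coe

/-- The Banach space `X` has the `l`-bounded approximation property (`1 ≤ l < ∞`). -/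
def HasBAP (X : Type*) [NormedAddCommGroup X] [NormedSpace ℝ X] [CompleteSpace X] (l : ℝ) : Prop :=
  1 ≤ l ∧ ∀ ε : ℝ, 0 < ε → ∀ K : Set X, IsCompact K →
    ∃ T : X →L[ℝ] X, FiniteDimensional ℝ (LinearMap.range (T : X →ₗ[ℝ] X)) ∧ ‖T‖ ≤ l ∧
      ∀ x ∈ K, ‖T x - x‖ ≤ ε

/-- `D > 0` is a doubling constant of `M`: every open ball is covered by at most `D` open balls
of half its radius. -/
def IsDoublingConstant (M : Type*) [MetricSpace M] (D : ℝ) : Prop :=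
  0 < D ∧ ∀ (p : M) (R : ℝ), 0 < R →
    ∃ s : Finset M, (s.card : ℝ) ≤ D ∧ Metric.ball p R ⊆ ⋃ q ∈ s, Metric.ball q (R / 2)

/-!
Why a doubling space with constant `D` has a free space with the `C (1 + log D)`-bounded
approximation property.

A compact subset of the free space is nearly contained in the span of `δ(N)` for a finite `N ∋ o`
in `M`, so it suffices to find operators of norm at most `C (1 + log D)` that map the free space
into `span δ(N)` and fix `δ(N)` (`hasBAP_closedSpan`). By linearization (`Lip0.ofDualMap`, whose
adjoint sends `δ(x)` to `μ x`) such an operator comes from a Lipschitz map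
`μ : M → span δ(N)` with `μ y = δ(y)` on `N`. Hence everything follows from an extension theorem,
`IsDoublingConstant.exists_lipschitz_extension`: a `1`-Lipschitz map from a finite `N ⊆ M` to a
normed space `E` extends to a `C (1 + log D)`-Lipschitz map on `M` with values in the span of its
image.

The extension is a Whitney-type average. For each `n : ℤ` fix a `2 ^ n`-net `S n` of `N`; for
`x ∉ N` the pair `(n, y)`, `y ∈ S n`, gets a tent-shaped weight `u`, a `1 / 2 ^ n`-Lipschitz
function of `x` that vanishes unless `2 ^ n` is comparable to `t = dist (x, N)` and `y` lies
within a bounded multiple of `2 ^ n` of `x`. The extension at `x` averages the values at `y` with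
weights proportional to `u ^ a`. By doubling, only `m ≤ 5 D ^ 5` pairs matter near `x`. The
power `a`, of order `log m`, is what makes the constant logarithmic: the derivative of `∑ u ^ a` is
controlled by `a ∑ u ^ (a - 1)`, and once `4 ^ a ≥ m` the many pairs with small `u` contribute at
most a constant multiple of the one pair with `u ≥ 1 / 2`, so that `∑ u ^ (a - 1) ≤ 16 ∑ u ^ a`
(`sum_pow_pred_le`). The normalized weights therefore change by `O(a d(x, x') / t)` in total
variation (`sum_abs_normalized_pow_sub_le`), while the values averaged differ by `O(t)`.
-/

/-! ### Normalized powers of finitely many weights -/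

open Finset in
/-- If at most `4 ^ a` nonnegative numbers include one that is at least `1 / 2`, lowering the
exponent from `a` to `a - 1` costs only a bounded factor in the sum of their `a`-th powers,
whatever their number. -/
theorem sum_pow_pred_le {ι : Type*} (B : Finset ι) (u : ι → ℝ) (a : ℕ) (ha : 1 ≤ a)
    (hu : ∀ i ∈ B, 0 ≤ u i) (hB : (#B : ℝ) ≤ 4 ^ a) (hmax : ∃ i ∈ B, 1 / 2 ≤ u i) :
    ∑ i ∈ B, u i ^ (a - 1) ≤ 16 * ∑ i ∈ B, u i ^ a := by
  obtain ⟨b, rfl⟩ : ∃ b, a = b + 1 := ⟨a - 1, by omega⟩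
  obtain ⟨j, hj, hju⟩ := hmax
  -- Values above the threshold `1 / 8` lose a factor `8`; the others are at most `(1 / 8) ^ b` each.
  have h1 : ∀ i ∈ B, u i ^ b ≤ 8 * u i ^ (b + 1) + (1 / 8) ^ b := by
    intro i hi
    rcases le_total (1 / 8) (u i) with h | h
    · have h0 : 0 ≤ u i ^ b := pow_nonneg (hu i hi) _
      have h8 : (0 : ℝ) ≤ (1 / 8) ^ b := by positivity
      rw [pow_succ]
      nlinarith
    · have h0 : 0 ≤ u i ^ (b + 1) := pow_nonneg (hu i hi) _
      have := pow_le_pow_left₀ (hu i hi) h b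
      linarith
  have h2 : (1 / 2 : ℝ) ^ (b + 1) ≤ ∑ i ∈ B, u i ^ (b + 1) :=
    (pow_le_pow_left₀ (by norm_num) hju _).trans
      (single_le_sum (f := fun i => u i ^ (b + 1)) (fun i hi => pow_nonneg (hu i hi) _) hj)
  have h3 : (#B : ℝ) * (1 / 8) ^ b ≤ 8 * (1 / 2) ^ (b + 1) := by
    calc (#B : ℝ) * (1 / 8) ^ b ≤ 4 ^ (b + 1) * (1 / 8) ^ b := by gcongr
      _ = 8 * (4 * (1 / 8)) ^ (b + 1) := by rw [mul_pow, pow_succ (1 / 8 : ℝ)]; ring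
      _ = _ := by norm_num
  calc ∑ i ∈ B, u i ^ b ≤ ∑ i ∈ B, (8 * u i ^ (b + 1) + (1 / 8) ^ b) := sum_le_sum h1
    _ = 8 * ∑ i ∈ B, u i ^ (b + 1) + #B * (1 / 8) ^ b := by
        rw [sum_add_distrib, mul_sum, sum_const, nsmul_eq_mul]
    _ ≤ _ := by linarith

open Finset in
theorem sum_abs_div_sum_sub_le_of_le {ι : Type*} (B : Finset ι) (f g : ι → ℝ)
    (hg : ∀ i ∈ B, 0 ≤ g i) (hG : 0 < ∑ i ∈ B, g i) (hGF : ∑ i ∈ B, g i ≤ ∑ i ∈ B, f i) :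
    ∑ i ∈ B, |f i / ∑ j ∈ B, f j - g i / ∑ j ∈ B, g j| ≤
      2 * (∑ i ∈ B, |f i - g i|) / ∑ j ∈ B, f j := by
  set F := ∑ j ∈ B, f j with hF
  set G := ∑ j ∈ B, g j with hG'
  have hF0 : 0 < F := hG.trans_le hGF
  have h1 : ∀ i ∈ B, |f i / F - g i / G| ≤ |f i - g i| / F + g i * (1 / G - 1 / F) := by
    intro i hi
    have hd : 0 ≤ 1 / G - 1 / F := sub_nonneg.2 (one_div_le_one_div_of_le hG hGF)
    have e : f i / F - g i / G = (f i - g i) / F + -(g i * (1 / G - 1 / F)) := by ring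
    rw [e]
    refine (abs_add_le _ _).trans ?_
    rw [abs_neg, abs_div, abs_of_pos hF0, abs_of_nonneg (mul_nonneg (hg i hi) hd)]
  have h2 : F - G ≤ ∑ i ∈ B, |f i - g i| := by
    rw [hF, hG', ← sum_sub_distrib]
    exact sum_le_sum fun i _ => le_abs_self _
  calc _ ≤ ∑ i ∈ B, (|f i - g i| / F + g i * (1 / G - 1 / F)) := sum_le_sum h1
    _ = (∑ i ∈ B, |f i - g i|) / F + (F - G) / F := by
        rw [sum_add_distrib, ← sum_div, ← sum_mul, ← hG']
        field_simp
    _ ≤ (∑ i ∈ B, |f i - g i|) / F + (∑ i ∈ B, |f i - g i|) / F := by gcongr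
    _ = _ := by ring

open Finset in
/-- Perturbing at most `4 ^ a` weights by `η` changes the probability vector proportional to their
`a`-th powers by `O(a η)` in `ℓ¹`. -/
theorem sum_abs_normalized_pow_sub_le {ι : Type*} (B : Finset ι) (u v : ι → ℝ) (a : ℕ)
    (ha : 1 ≤ a) (hu : ∀ i ∈ B, 0 ≤ u i) (hv : ∀ i ∈ B, 0 ≤ v i) (hB : (#B : ℝ) ≤ 4 ^ a)
    (humax : ∃ i ∈ B, 1 / 2 ≤ u i) (hvmax : ∃ i ∈ B, 1 / 2 ≤ v i) {η : ℝ}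
    (hη : ∀ i ∈ B, |u i - v i| ≤ η) :
    ∑ i ∈ B, |u i ^ a / ∑ j ∈ B, u j ^ a - v i ^ a / ∑ j ∈ B, v j ^ a| ≤ 64 * a * η := by
  wlog h : ∑ j ∈ B, v j ^ a ≤ ∑ j ∈ B, u j ^ a generalizing u v
  · have := this v u hv hu hvmax humax (fun i hi => by rw [abs_sub_comm]; exact hη i hi)
      (le_of_not_ge h)
    simpa only [abs_sub_comm] using this
  have hV : 0 < ∑ j ∈ B, v j ^ a := by
    obtain ⟨j, hj, hjv⟩ := hvmax
    exact (pow_pos (by linarith) a).trans_le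
      (single_le_sum (f := fun i => v i ^ a) (fun i hi => pow_nonneg (hv i hi) _) hj)
  have hη0 : 0 ≤ η := by
    obtain ⟨j, hj, -⟩ := hvmax
    exact (abs_nonneg _).trans (hη j hj)
  refine (sum_abs_div_sum_sub_le_of_le B _ _ (fun i hi => pow_nonneg (hv i hi) _) hV h).trans ?_
  rw [div_le_iff₀ (hV.trans_le h)]
  have h1 : ∀ i ∈ B, |u i ^ a - v i ^ a| ≤ a * η * (u i ^ (a - 1) + v i ^ (a - 1)) := by
    intro i hi
    refine (abs_pow_sub_pow_le _ _ _).trans ?_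
    rw [abs_of_nonneg (hu i hi), abs_of_nonneg (hv i hi)]
    have hm : max (u i) (v i) ^ (a - 1) ≤ u i ^ (a - 1) + v i ^ (a - 1) := by
      have h0 := pow_nonneg (hu i hi) (a - 1)
      have h0' := pow_nonneg (hv i hi) (a - 1)
      rcases max_cases (u i) (v i) with ⟨e, -⟩ | ⟨e, -⟩ <;> rw [e] <;> linarith
    have hm0 : 0 ≤ max (u i) (v i) ^ (a - 1) := pow_nonneg (le_max_of_le_left (hu i hi)) _
    calc |u i - v i| * a * max (u i) (v i) ^ (a - 1)
        ≤ η * a * (u i ^ (a - 1) + v i ^ (a - 1)) := by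
          gcongr
          exact hη i hi
      _ = _ := by ring
  have h2 : ∑ i ∈ B, |u i ^ a - v i ^ a| ≤ a * η * (32 * ∑ j ∈ B, u j ^ a) := by
    refine (sum_le_sum h1).trans ?_
    rw [← mul_sum, sum_add_distrib]
    have := sum_pow_pred_le B u a ha hu hB humax
    have := sum_pow_pred_le B v a ha hv hB hvmax
    gcongr
    linarith
  linarith

/-! ### Doubling and separated sets -/

namespace IsDoublingConstant

variable {M : Type*} [MetricSpace M] {D : ℝ}

theorem one_le (hD : IsDoublingConstant M D) (p : M) : 1 ≤ D := by
  obtain ⟨s, hs, hc⟩ := hD.2 p 1 one_pos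
  obtain ⟨q, hq, -⟩ := Set.mem_iUnion₂.1 (hc (Metric.mem_ball_self one_pos))
  refine le_trans ?_ hs
  exact_mod_cast Finset.card_pos.2 ⟨q, hq⟩

theorem exists_cover_pow (hD : IsDoublingConstant M D) (k : ℕ) (p : M) {R : ℝ} (hR : 0 < R) :
    ∃ s : Finset M, (s.card : ℝ) ≤ D ^ k ∧
      Metric.ball p R ⊆ ⋃ q ∈ s, Metric.ball q (R / 2 ^ k) := by
  classical
  induction k with
  | zero => exact ⟨{p}, by simp, by simp⟩
  | succ k ih =>
    obtain ⟨s, hs, hc⟩ := ih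
    choose c hcard hcov using fun q : M => hD.2 q (R / 2 ^ k) (by positivity)
    refine ⟨s.biUnion c, ?_, fun x hx => ?_⟩
    · calc ((s.biUnion c).card : ℝ) ≤ ∑ q ∈ s, ((c q).card : ℝ) := by
            exact_mod_cast Finset.card_biUnion_le
        _ ≤ ∑ q ∈ s, D := Finset.sum_le_sum fun q _ => hcard q
        _ = s.card * D := by rw [Finset.sum_const, nsmul_eq_mul]
        _ ≤ D ^ k * D := mul_le_mul_of_nonneg_right hs hD.1.le
        _ = _ := (pow_succ _ _).symm
    · obtain ⟨q, hq, hxq⟩ := Set.mem_iUnion₂.1 (hc hx)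
      obtain ⟨q', hq', hxq'⟩ := Set.mem_iUnion₂.1 (hcov q hxq)
      refine Set.mem_iUnion₂.2 ⟨q', Finset.mem_biUnion.2 ⟨q, hq, hq'⟩, ?_⟩
      rwa [pow_succ, ← div_div]

theorem card_separated_le (hD : IsDoublingConstant M D) (k : ℕ) (p : M) {r : ℝ} (hr : 0 < r)
    (A : Finset M) (hA : ∀ x ∈ A, dist x p < 2 ^ k * r)
    (hsep : ∀ x ∈ A, ∀ y ∈ A, x ≠ y → r ≤ dist x y) : (A.card : ℝ) ≤ D ^ (k + 1) := by
  obtain ⟨s, hs, hc⟩ := hD.exists_cover_pow (k + 1) p (R := 2 ^ k * r) (by positivity)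
  have hrad : 2 ^ k * r / 2 ^ (k + 1) = r / 2 := by
    rw [pow_succ, mul_div_mul_left _ _ (by positivity)]
  have h : ∀ x ∈ A, ∃ q ∈ s, dist x q < r / 2 := fun x hx => by
    obtain ⟨q, hq, hxq⟩ := Set.mem_iUnion₂.1 (hc (hA x hx))
    exact ⟨q, hq, by rwa [hrad] at hxq⟩
  choose! c hcs hcd using h
  refine le_trans ?_ hs
  have := Finset.card_le_card_of_injOn c hcs fun x hx y hy hxy => by
    by_contra hne
    have h1 := hsep x hx y hy hne
    have h2 := hcd x hx
    have h3 := hcd y hy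
    rw [← hxy, dist_comm] at h3
    linarith [dist_triangle x (c x) y]
  exact_mod_cast this

end IsDoublingConstant

/-- A finite set has a subset that is `r`-separated and an `r`-net. -/
theorem Finset.exists_separated_net {M : Type*} [MetricSpace M] (N : Finset M) {r : ℝ}
    (hr : 0 < r) : ∃ S ⊆ N, (∀ x ∈ S, ∀ y ∈ S, x ≠ y → r ≤ dist x y) ∧
      ∀ y ∈ N, ∃ s ∈ S, dist y s < r := by
  classical
  induction N using Finset.induction_on with
  | empty => exact ⟨∅, by simp⟩
  | insert b N hb ih =>
    obtain ⟨S, hSN, hsep, hnet⟩ := ih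
    by_cases h : ∃ s ∈ S, dist b s < r
    · exact ⟨S, hSN.trans (Finset.subset_insert _ _), hsep,
        (Finset.forall_mem_insert _ _ _).2 ⟨h, hnet⟩⟩
    · push Not at h
      refine ⟨insert b S, Finset.insert_subset_insert _ hSN, ?_, ?_⟩
      · intro x hx y hy hxy
        rcases Finset.mem_insert.1 hx with hx | hx <;> rcases Finset.mem_insert.1 hy with hy | hy
        · exact absurd (hx.trans hy.symm) hxy
        · exact hx ▸ h y hy
        · rw [hy, dist_comm]; exact h x hx
        · exact hsep x hx y hy hxy
      · refine (Finset.forall_mem_insert _ _ _).2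
          ⟨⟨b, Finset.mem_insert_self _ _, by simpa using hr⟩, fun y hy => ?_⟩
        obtain ⟨s, hs, hys⟩ := hnet y hy
        exact ⟨s, Finset.mem_insert_of_mem hs, hys⟩

/-! ### Evaluation functionals and linearization -/

namespace Lip0

variable {M : Type*} [MetricSpace M] {o : M}

theorem dirac_base : dirac o o = 0 := by
  ext f
  exact apply_base f

theorem norm_dirac_sub_le (p q : M) : ‖dirac o p - dirac o q‖ ≤ dist p q :=
  ContinuousLinearMap.opNorm_le_bound _ dist_nonneg fun f => by
    rw [mul_comm]
    exact abs_sub_le f p q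

/-- The operator `f ↦ (x ↦ ⟨f, μ x⟩)` on `Lip₀(M)` defined by a Lipschitz map `μ` into the dual
that vanishes at the base point. -/
noncomputable def ofDualMap (μ : M → StrongDual ℝ (Lip0 M o)) (L : ℝ≥0) (hμ : LipschitzWith L μ)
    (hμ0 : μ o = 0) : Lip0 M o →L[ℝ] Lip0 M o :=
  have h : ∀ (f : Lip0 M o) (x y : M), |μ x f - μ y f| ≤ L * ‖f‖ * dist x y := fun f x y => by
    have h1 := (μ x - μ y).le_opNorm f
    have h2 := hμ.dist_le_mul x y
    rw [dist_eq_norm] at h2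
    calc |μ x f - μ y f| ≤ ‖μ x - μ y‖ * ‖f‖ := h1
      _ ≤ L * dist x y * ‖f‖ := by gcongr
      _ = _ := by ring
  LinearMap.mkContinuous
    { toFun := fun f => ⟨fun x => μ x f, ⟨L * ‖f‖₊, LipschitzWith.of_dist_le_mul fun x y => h f x y⟩,
        by simp [hμ0]⟩
      map_add' := fun f g => ext fun x => map_add (μ x) f g
      map_smul' := fun c f => ext fun x => map_smul (μ x) c f }
    L fun f => norm_le_of (by positivity) (h f)

theorem norm_ofDualMap_le (μ : M → StrongDual ℝ (Lip0 M o)) (L : ℝ≥0) (hμ : LipschitzWith L μ)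
    (hμ0 : μ o = 0) : ‖ofDualMap μ L hμ hμ0‖ ≤ L := by
  unfold ofDualMap
  exact LinearMap.mkContinuous_norm_le _ L.2 _

end Lip0

/-! ### Bounded approximation property of a closed span -/

section ClosedSpan

variable {W : Type*} [NormedAddCommGroup W] [NormedSpace ℝ W]

/-- The restriction of `A` to the closed span of `s`: `A` maps `span s` into `span t`, which is
closed because it is finite-dimensional, and so it maps the closure there as well. -/
theorem ContinuousLinearMap.exists_finiteRank_of_mapsTo_span {s t : Set W} (ht : t.Finite)
    (hts : t ⊆ s) (A : W →L[ℝ] W) (hAs : ∀ w ∈ s, A w ∈ Submodule.span ℝ t)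
    (hAt : ∀ w ∈ t, A w = w) :
    ∃ T : (Submodule.span ℝ s).topologicalClosure →L[ℝ] (Submodule.span ℝ s).topologicalClosure,
      FiniteDimensional ℝ (LinearMap.range (T : (Submodule.span ℝ s).topologicalClosure →ₗ[ℝ]
        (Submodule.span ℝ s).topologicalClosure)) ∧
      ‖T‖ ≤ ‖A‖ ∧ ∀ c : (Submodule.span ℝ s).topologicalClosure,
        (c : W) ∈ Submodule.span ℝ t → T c = c := by
  set V := Submodule.span ℝ t with hV
  set F := (Submodule.span ℝ s).topologicalClosure
  have hVfin : FiniteDimensional ℝ V := FiniteDimensional.span_of_finite ℝ ht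
  have hVF : V ≤ F := (Submodule.span_mono hts).trans (Submodule.le_topologicalClosure _)
  have hAV : ∀ w ∈ F, A w ∈ V := by
    have hcl : IsClosed ((V.comap (A : W →ₗ[ℝ] W) : Submodule ℝ W) : Set W) :=
      V.closed_of_finiteDimensional.preimage A.continuous
    exact Submodule.topologicalClosure_minimal _ (Submodule.span_le.2 fun w hw => hAs w hw) hcl
  have hAid : ∀ w ∈ V, A w = w := by
    intro w hw
    induction hw using Submodule.span_induction with
    | mem w h => exact hAt w h
    | zero => exact map_zero A
    | add v w _ _ h1 h2 => rw [map_add, h1, h2]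
    | smul c w _ h => rw [map_smul, h]
  refine ⟨(A.comp F.subtypeL).codRestrict F (fun w => hVF (hAV w w.2)), ?_, ?_, ?_⟩
  · have : FiniteDimensional ℝ (V.comap F.subtype) :=
      (Submodule.comapSubtypeEquivOfLe hVF).symm.finiteDimensional
    refine Submodule.finiteDimensional_of_le (S₂ := V.comap F.subtype) ?_
    rintro _ ⟨w, rfl⟩
    exact hAV w w.2
  · exact ContinuousLinearMap.opNorm_le_bound _ (norm_nonneg A) fun w => A.le_opNorm w
  · exact fun c hc => Subtype.ext (hAid c hc)

theorem Submodule.exists_finite_span_near {s : Set W}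
    {K : Set (Submodule.span ℝ s).topologicalClosure} (hK : IsCompact K) {η : ℝ} (hη : 0 < η) :
    ∃ t ⊆ s, t.Finite ∧ ∀ x ∈ K, ∃ c : (Submodule.span ℝ s).topologicalClosure,
      (c : W) ∈ Submodule.span ℝ t ∧ ‖x - c‖ < η := by
  obtain ⟨b, -, hbf, hb⟩ := hK.finite_cover_balls (half_pos hη)
  have h : ∀ x : (Submodule.span ℝ s).topologicalClosure,
      ∃ (t : Finset W) (c : (Submodule.span ℝ s).topologicalClosure), (t : Set W) ⊆ s ∧
        (c : W) ∈ Submodule.span ℝ (t : Set W) ∧ ‖x - c‖ < η / 2 := by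
    intro x
    obtain ⟨c, hc, hxc⟩ := Metric.mem_closure_iff.1 x.2 (η / 2) (half_pos hη)
    obtain ⟨t, ht, hct⟩ := Submodule.mem_span_finite_of_mem_span hc
    rw [dist_eq_norm] at hxc
    exact ⟨t, ⟨c, Submodule.le_topologicalClosure _ hc⟩, ht, hct, hxc⟩
  choose t c hts hct hcd using h
  refine ⟨⋃ y ∈ b, t y, Set.iUnion₂_subset fun y _ => hts y,
    hbf.biUnion fun y _ => (t y).finite_toSet, fun x hx => ?_⟩
  obtain ⟨y, hy, hxy⟩ := Set.mem_iUnion₂.1 (hb hx)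
  refine ⟨c y, Submodule.span_mono (Set.subset_biUnion_of_mem hy) (hct y), ?_⟩
  rw [Metric.mem_ball, dist_eq_norm] at hxy
  calc ‖x - c y‖ = ‖(x - y) + (y - c y)‖ := by rw [sub_add_sub_cancel]
    _ ≤ ‖x - y‖ + ‖y - c y‖ := norm_add_le _ _
    _ < η := by linarith [hcd y]

/-- A closed span has the `l`-bounded approximation property if every finite part of the spanning
set is contained in a finite part `t'` onto whose span an operator of norm at most `l` projects
the whole span. -/
theorem hasBAP_closedSpan {s : Set W} [CompleteSpace (Submodule.span ℝ s).topologicalClosure]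
    {l : ℝ} (hl : 1 ≤ l)
    (h : ∀ t ⊆ s, t.Finite → ∃ t' ⊆ s, t ⊆ t' ∧ t'.Finite ∧ ∃ A : W →L[ℝ] W, ‖A‖ ≤ l ∧
      (∀ w ∈ s, A w ∈ Submodule.span ℝ t') ∧ ∀ w ∈ t', A w = w) :
    HasBAP (Submodule.span ℝ s).topologicalClosure l := by
  refine ⟨hl, fun ε hε K hK => ?_⟩
  obtain ⟨t, hts, htf, htK⟩ := Submodule.exists_finite_span_near hK (η := ε / (l + 1))
    (by positivity)
  obtain ⟨t', hts', htt', htf', A, hA, hAs, hAt⟩ := h t hts htf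
  obtain ⟨T, hT, hTA, hTid⟩ := A.exists_finiteRank_of_mapsTo_span htf' hts' hAs hAt
  refine ⟨T, hT, hTA.trans hA, fun x hx => ?_⟩
  obtain ⟨c, hc, hxc⟩ := htK x hx
  have e : T x - x = T (x - c) - (x - c) := by
    rw [map_sub, hTid c (Submodule.span_mono htt' hc)]; abel
  calc ‖T x - x‖ ≤ ‖T (x - c)‖ + ‖x - c‖ := by rw [e]; exact norm_sub_le _ _
    _ ≤ l * ‖x - c‖ + ‖x - c‖ := by
        gcongr
        exact T.le_of_opNorm_le (hTA.trans hA) _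
    _ = (l + 1) * ‖x - c‖ := by ring
    _ ≤ (l + 1) * (ε / (l + 1)) := by gcongr
    _ = ε := by field_simp

end ClosedSpan

/-! ### Whitney-type averages over nets -/

/-- The choice of the exponent: `4 ^ a` dominates the number of relevant weights, with `a` of order
`1 + log D`. -/
theorem exists_nat_le_four_pow {D : ℝ} (hD : 1 ≤ D) :
    ∃ a : ℕ, 1 ≤ a ∧ 5 * D ^ 5 ≤ 4 ^ a ∧ (a : ℝ) ≤ 6 * (1 + Real.log D) := by
  have hlog : 0 ≤ Real.log D := Real.log_nonneg hD
  have hpos : 0 < 5 * D ^ 5 := by positivity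
  have h5 : Real.log (5 * D ^ 5) = Real.log 5 + 5 * Real.log D := by
    rw [Real.log_mul (by norm_num) (by positivity), Real.log_pow]
    norm_num
  have h5' : Real.log 5 ≤ 4 := by
    have := Real.log_le_sub_one_of_pos (show (0 : ℝ) < 5 by norm_num)
    linarith
  have h5'' : 0 < Real.log 5 := Real.log_pos (by norm_num)
  have hx : 0 < Real.log (5 * D ^ 5) := by rw [h5]; linarith
  refine ⟨⌈Real.log (5 * D ^ 5)⌉₊, Nat.ceil_pos.2 hx, ?_, ?_⟩
  · calc 5 * D ^ 5 = Real.exp (Real.log (5 * D ^ 5)) := (Real.exp_log hpos).symm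
      _ ≤ Real.exp ⌈Real.log (5 * D ^ 5)⌉₊ := Real.exp_le_exp.2 (Nat.le_ceil _)
      _ = Real.exp 1 ^ ⌈Real.log (5 * D ^ 5)⌉₊ := Real.exp_one_pow _ |>.symm
      _ ≤ 4 ^ ⌈Real.log (5 * D ^ 5)⌉₊ := by
          gcongr
          linarith [Real.exp_one_lt_d9]
  · have := Nat.ceil_lt_add_one hx.le
    linarith

namespace Whitney

/-- The weight of a net point at scale `r` and distance `d` from a point whose distance to `N`
is `t`: a tent, positive only for `d < 8 r` and `r / 2 < t < 4 r`. -/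
noncomputable def bump (r d t : ℝ) : ℝ :=
  max 0 (min (1 - d / (8 * r)) (min (t / r - 1 / 2) (1 - t / (4 * r))))

theorem bump_nonneg (r d t : ℝ) : 0 ≤ bump r d t := le_max_left _ _

theorem of_bump_ne_zero {r d t : ℝ} (hr : 0 < r) (h : bump r d t ≠ 0) :
    d < 8 * r ∧ r < 2 * t ∧ t < 4 * r := by
  have h0 : 0 < min (1 - d / (8 * r)) (min (t / r - 1 / 2) (1 - t / (4 * r))) := by
    by_contra hc
    exact h (max_eq_left (not_lt.1 hc))
  obtain ⟨h1, h2, h3⟩ : _ ∧ _ ∧ _ := by simpa only [lt_min_iff, sub_pos] using h0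
  rw [div_lt_one (by positivity)] at h1 h3
  rw [lt_div_iff₀ hr] at h2
  exact ⟨h1, by linarith, h3⟩

theorem half_le_bump {r d t : ℝ} (hr : 0 < r) (h1 : r ≤ t) (h2 : t ≤ 2 * r) (hd : d ≤ 3 * r) :
    1 / 2 ≤ bump r d t := by
  refine le_max_of_le_right (le_min ?_ (le_min ?_ ?_))
  · have : d / (8 * r) ≤ 1 / 2 := by rw [div_le_iff₀ (by positivity)]; linarith
    linarith
  · have : 1 ≤ t / r := by rwa [one_le_div hr]
    linarith
  · have : t / (4 * r) ≤ 1 / 2 := by rw [div_le_iff₀ (by positivity)]; linarith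
    linarith

theorem abs_bump_sub_le {r d d' t t' η : ℝ} (hr : 0 < r) (hd : |d - d'| ≤ η)
    (ht : |t - t'| ≤ η) : |bump r d t - bump r d' t'| ≤ η / r := by
  have hη : 0 ≤ η := (abs_nonneg _).trans hd
  refine (abs_max_sub_max_le_max _ _ _ _).trans (max_le (by simp; positivity) ?_)
  refine (abs_min_sub_min_le_max _ _ _ _).trans (max_le ?_ ?_)
  · have e : 1 - d / (8 * r) - (1 - d' / (8 * r)) = -((d - d') / (8 * r)) := by ring
    rw [e, abs_neg, abs_div, abs_of_pos (show 0 < 8 * r by positivity)]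
    gcongr
    linarith
  refine (abs_min_sub_min_le_max _ _ _ _).trans (max_le ?_ ?_)
  · have e : t / r - 1 / 2 - (t' / r - 1 / 2) = (t - t') / r := by ring
    rw [e, abs_div, abs_of_pos hr]
    gcongr
  · have e : 1 - t / (4 * r) - (1 - t' / (4 * r)) = -((t - t') / (4 * r)) := by ring
    rw [e, abs_neg, abs_div, abs_of_pos (show 0 < 4 * r by positivity)]
    gcongr
    linarith

variable {M : Type*} [MetricSpace M]

open Classical in
/-- The weight at `x` of the pair `z = (n, y)`, where `y` belongs to the net `S n` of `N` at scale
`2 ^ n`; it is `0` if `y ∉ S n`. Pairs are encoded as a sigma type so that finite windows of scales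
are `Finset.sigma`s. -/
noncomputable def weight (N : Set M) (S : ℤ → Finset M) (x : M) (z : Σ _ : ℤ, M) : ℝ :=
  if z.2 ∈ S z.1 then bump (2 ^ z.1) (dist x z.2) (Metric.infDist x N) else 0

variable {N : Set M} {S : ℤ → Finset M}

theorem weight_nonneg (x : M) (z : Σ _ : ℤ, M) : 0 ≤ weight N S x z := by
  unfold weight
  split_ifs
  exacts [bump_nonneg _ _ _, le_rfl]

theorem of_weight_ne_zero {x : M} {z : Σ _ : ℤ, M} (h : weight N S x z ≠ 0) :
    z.2 ∈ S z.1 ∧ dist x z.2 < 8 * 2 ^ z.1 ∧ 2 ^ z.1 < 2 * Metric.infDist x N ∧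
      Metric.infDist x N < 4 * 2 ^ z.1 := by
  unfold weight at h
  split_ifs at h with hz
  · exact ⟨hz, of_bump_ne_zero (by positivity) h⟩
  · exact absurd rfl h

theorem abs_weight_sub_le (x y : M) (z : Σ _ : ℤ, M) :
    |weight N S x z - weight N S y z| ≤ dist x y / 2 ^ z.1 := by
  unfold weight
  split_ifs
  · refine abs_bump_sub_le (by positivity) (abs_dist_sub_le _ _ _) ?_
    simpa [Real.dist_eq] using (Metric.lipschitz_infDist_pt N).dist_le_mul x y
  · simp; positivity

theorem exists_half_le_weight {N : Finset M} (hN : N.Nonempty)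
    (hnet : ∀ n, ∀ y ∈ N, ∃ s ∈ S n, dist y s < 2 ^ n) {x : M}
    (hx : 0 < Metric.infDist x N) : ∃ z, 1 / 2 ≤ weight (N : Set M) S x z := by
  obtain ⟨m, hm1, hm2⟩ := exists_mem_Ico_zpow hx one_lt_two
  obtain ⟨y, hy, hxy⟩ := N.finite_toSet.isCompact.exists_infDist_eq_dist hN.to_set x
  obtain ⟨s, hs, hys⟩ := hnet m y hy
  rw [zpow_add_one₀ two_ne_zero] at hm2
  refine ⟨⟨m, s⟩, ?_⟩
  rw [weight, if_pos hs]
  refine half_le_bump (by positivity) hm1 (by linarith) ?_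
  linarith [dist_triangle x y s]

/-- Near a point `x` at distance `t > 0` from `N`, that is, on the ball of radius `t / 4`, all
nonzero weights belong to one set of at most `5 D ^ 5` pairs: five scales are comparable to `t`, and
at each of them packing bounds the number of net points. -/
theorem exists_window {D : ℝ} (hD : IsDoublingConstant M D)
    (hsep : ∀ n, ∀ x ∈ S n, ∀ y ∈ S n, x ≠ y → 2 ^ n ≤ dist x y) {x : M}
    (hx : 0 < Metric.infDist x N) :
    ∃ B : Finset (Σ _ : ℤ, M), (B.card : ℝ) ≤ 5 * D ^ 5 ∧
      (∀ x', dist x x' < Metric.infDist x N / 4 → ∀ z, weight N S x' z ≠ 0 → z ∈ B) ∧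
      ∀ z ∈ B, z.2 ∈ S z.1 ∧ Metric.infDist x N ≤ 8 * 2 ^ z.1 ∧
        dist x z.2 ≤ 64 * Metric.infDist x N := by
  classical
  obtain ⟨m, hm1, hm2⟩ := exists_mem_Ico_zpow hx one_lt_two
  set t := Metric.infDist x N
  have h8 : (2 : ℝ) ^ (m + 3) = 8 * 2 ^ m := by rw [zpow_add₀ two_ne_zero]; norm_num; ring
  have h8' : (2 : ℝ) ^ m = 8 * 2 ^ (m - 3) := by
    rw [zpow_sub₀ two_ne_zero]; norm_num; ring
  have h4 : (2 : ℝ) ^ (m + 2) = 4 * 2 ^ m := by rw [zpow_add₀ two_ne_zero]; norm_num; ring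
  have h4' : (2 : ℝ) ^ (m + 1) = 8 * 2 ^ (m - 2) := by
    rw [zpow_sub₀ two_ne_zero, zpow_add₀ two_ne_zero]; norm_num; ring
  have h2 : (2 : ℝ) ^ (m + 1) = 2 * 2 ^ m := by rw [zpow_add₀ two_ne_zero]; norm_num; ring
  refine ⟨(Finset.Icc (m - 2) (m + 2)).sigma fun n => (S n).filter fun y => dist y x < 2 ^ 4 * 2 ^ n,
    ?_, ?_, ?_⟩
  · rw [Finset.card_sigma]
    push_cast
    calc _ ≤ ∑ n ∈ Finset.Icc (m - 2) (m + 2), D ^ 5 := Finset.sum_le_sum fun n _ =>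
          hD.card_separated_le 4 x (by positivity) _ (fun y hy => (Finset.mem_filter.1 hy).2)
            fun y hy y' hy' => hsep n y (Finset.mem_filter.1 hy).1 y' (Finset.mem_filter.1 hy').1
      _ = 5 * D ^ 5 := by
          rw [Finset.sum_const, Int.card_Icc, show m + 2 + 1 - (m - 2) = 5 by ring]
          simp
  · rintro x' hx' ⟨n, y⟩ hz
    obtain ⟨hyS, hyd, hn1, hn2⟩ := of_weight_ne_zero hz
    dsimp only at hyS hyd hn1 hn2
    have ht1 : t ≤ Metric.infDist x' N + dist x x' := Metric.infDist_le_infDist_add_dist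
    have ht2 : Metric.infDist x' N ≤ t + dist x' x := Metric.infDist_le_infDist_add_dist
    rw [dist_comm x' x] at ht2
    refine Finset.mem_sigma.2 ⟨Finset.mem_Icc.2 ⟨?_, ?_⟩, Finset.mem_filter.2 ⟨hyS, ?_⟩⟩
    · by_contra! hlt
      have : (2 : ℝ) ^ n ≤ 2 ^ (m - 3) :=
        zpow_le_zpow_right₀ one_le_two (by dsimp only at hlt; omega)
      linarith
    · by_contra! hlt
      have : (2 : ℝ) ^ (m + 3) ≤ 2 ^ n :=
        zpow_le_zpow_right₀ one_le_two (by dsimp only at hlt; omega)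
      linarith
    · dsimp only
      rw [dist_comm]
      linarith [dist_triangle x x' y]
  · rintro ⟨n, y⟩ hz
    obtain ⟨hn, hy⟩ := Finset.mem_sigma.1 hz
    obtain ⟨hn1, hn2⟩ := Finset.mem_Icc.1 hn
    obtain ⟨hyS, hyd⟩ := Finset.mem_filter.1 hy
    dsimp only at *
    have h1 : (2 : ℝ) ^ (m - 2) ≤ 2 ^ n := zpow_le_zpow_right₀ one_le_two hn1
    have h2 : (2 : ℝ) ^ n ≤ 2 ^ (m + 2) := zpow_le_zpow_right₀ one_le_two hn2
    refine ⟨hyS, by linarith, ?_⟩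
    rw [dist_comm]
    linarith

variable {E : Type*} [NormedAddCommGroup E] [NormedSpace ℝ E]

/-- The average of `g` over the net points of all scales, with the `a`-th powers of the weights,
normalized. It is the junk value `0` at points of `N`, where all weights vanish. -/
noncomputable def average (N : Set M) (S : ℤ → Finset M) (a : ℕ) (g : M → E) (x : M) : E :=
  ∑ᶠ z, (weight N S x z ^ a / ∑ᶠ z', weight N S x z' ^ a) • g z.2

theorem average_eq_sum {a : ℕ} (ha : a ≠ 0) (g : M → E) {x : M} {B : Finset (Σ _ : ℤ, M)}
    (hB : ∀ z, weight N S x z ≠ 0 → z ∈ B) :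
    average N S a g x =
      ∑ z ∈ B, (weight N S x z ^ a / ∑ z' ∈ B, weight N S x z' ^ a) • g z.2 := by
  have h0 : ∀ z, z ∉ B → weight N S x z ^ a = 0 := fun z hz => by
    rw [not_imp_comm.1 (hB z) hz, zero_pow ha]
  have h1 : ∑ᶠ z, weight N S x z ^ a = ∑ z ∈ B, weight N S x z ^ a :=
    finsum_eq_sum_of_support_subset _ fun z hz => not_imp_comm.1 (h0 z) hz
  rw [average, h1]
  refine finsum_eq_sum_of_support_subset _ fun z hz => not_imp_comm.1 (fun hzB => ?_) hz
  beta_reduce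
  rw [h0 z hzB, zero_div, zero_smul]

end Whitney

open Whitney in
/-- A `1`-Lipschitz map from a finite subset `N` of a doubling space to a normed space extends to a
Lipschitz map with constant `O(1 + log D)` and values in the span of the image of `N`. Points
whose distance is at least a quarter of their distance to `N` are compared through nearest points
of `N`; for closer points the weights of the two averages are compared. -/
theorem IsDoublingConstant.exists_lipschitz_extension {M : Type*} [MetricSpace M] {D : ℝ}
    (hD : IsDoublingConstant M D) {E : Type*} [NormedAddCommGroup E] [NormedSpace ℝ E]
    (N : Finset M) (hN : N.Nonempty) (g : M → E)
    (hg : ∀ y ∈ N, ∀ y' ∈ N, ‖g y - g y'‖ ≤ dist y y') :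
    ∃ μ : M → E, (∀ x y, ‖μ x - μ y‖ ≤ 200000 * (1 + Real.log D) * dist x y) ∧
      (∀ x, μ x ∈ Submodule.span ℝ (g '' N)) ∧ ∀ y ∈ N, μ y = g y := by
  classical
  have hD1 : 1 ≤ D := hD.one_le hN.choose
  have hlog : 0 ≤ Real.log D := Real.log_nonneg hD1
  obtain ⟨a, ha1, ha4, hale⟩ := exists_nat_le_four_pow hD1
  have ha0 : a ≠ 0 := by omega
  choose S hSN hsep hnet using fun n : ℤ =>
    N.exists_separated_net (r := 2 ^ n) (by positivity)
  set t : M → ℝ := fun x => Metric.infDist x N with ht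
  have ht0 : ∀ x, x ∉ N → 0 < t x := fun x hx =>
    (N.finite_toSet.isClosed.notMem_iff_infDist_pos hN.to_set).1 hx
  have hnn : ∀ x, ∃ y ∈ N, dist x y = t x := fun x => by
    obtain ⟨y, hy, h⟩ := N.finite_toSet.isCompact.exists_infDist_eq_dist hN.to_set x
    exact ⟨y, hy, h.symm⟩
  have hsum : ∀ x (B : Finset (Σ _ : ℤ, M)), 0 < t x →
      (∀ z, weight (N : Set M) S x z ≠ 0 → z ∈ B) →
      (∃ z ∈ B, 1 / 2 ≤ weight (N : Set M) S x z) ∧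
      ∑ z ∈ B, weight (N : Set M) S x z ^ a / ∑ z' ∈ B, weight (N : Set M) S x z' ^ a = 1 := by
    intro x B hx hB
    obtain ⟨z, hz⟩ := exists_half_le_weight hN hnet hx
    have hzB : z ∈ B := hB z (by linarith)
    refine ⟨⟨z, hzB, hz⟩, ?_⟩
    rw [← Finset.sum_div]
    refine div_self (ne_of_gt ?_)
    exact (pow_pos (by linarith) a).trans_le (Finset.single_le_sum
      (f := fun z => weight (N : Set M) S x z ^ a) (fun i _ => pow_nonneg (weight_nonneg _ _) _) hzB)
  set μ : M → E := fun x => if x ∈ N then g x else average (N : Set M) S a g x with hμ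
  have hμN : ∀ y ∈ N, μ y = g y := fun y hy => if_pos hy
  have hμN' : ∀ x, x ∉ N → μ x = average (N : Set M) S a g x := fun y hy => if_neg hy
  have hnear : ∀ x, ∀ y ∈ N, dist x y = t x → ‖μ x - g y‖ ≤ 65 * t x := by
    intro x y hy hxy
    by_cases hx : x ∈ N
    · have h0 : t x = 0 := Metric.infDist_zero_of_mem hx
      obtain rfl : x = y := dist_eq_zero.1 (hxy.trans h0)
      rw [hμN x hx, h0]
      simp
    obtain ⟨B, -, hB, hBd⟩ := exists_window hD hsep (ht0 x hx)
    have hBx := hB x (by simpa using ht0 x hx)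
    obtain ⟨-, h1⟩ := hsum x B (ht0 x hx) hBx
    rw [hμN' x hx, average_eq_sum ha0 g hBx]
    set p := fun z => weight (N : Set M) S x z ^ a / ∑ z' ∈ B, weight (N : Set M) S x z' ^ a
    have hp : ∀ z, 0 ≤ p z := fun z => div_nonneg (pow_nonneg (weight_nonneg _ _) _)
      (Finset.sum_nonneg fun i _ => pow_nonneg (weight_nonneg _ _) _)
    have e : ∑ z ∈ B, p z • g z.2 - g y = ∑ z ∈ B, p z • (g z.2 - g y) := by
      simp only [smul_sub, Finset.sum_sub_distrib, ← Finset.sum_smul]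
      rw [h1, one_smul]
    calc ‖∑ z ∈ B, p z • g z.2 - g y‖ ≤ ∑ z ∈ B, p z * (65 * t x) := by
          rw [e]
          refine norm_sum_le_of_le _ fun z hz => ?_
          obtain ⟨hzS, -, hzd⟩ := hBd z hz
          rw [norm_smul, Real.norm_eq_abs, abs_of_nonneg (hp z)]
          refine mul_le_mul_of_nonneg_left ((hg _ (hSN _ hzS) y hy).trans ?_) (hp z)
          have := dist_triangle_left z.2 y x
          linarith
      _ = 65 * t x := by rw [← Finset.sum_mul, h1, one_mul]
  refine ⟨μ, ?_, ?_, hμN⟩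
  · intro x x'
    -- The larger distance to `N` sets the scale.
    wlog hle : t x' ≤ t x generalizing x x'
    · rw [norm_sub_rev, dist_comm]
      exact this x' x (le_of_not_ge hle)
    obtain ⟨y, hy, hxy⟩ := hnn x
    rcases le_or_gt (t x / 4) (dist x x') with hfar | hclose
    · obtain ⟨y', hy', hxy'⟩ := hnn x'
      have h1 := hnear x y hy hxy
      have h2 := hnear x' y' hy' hxy'
      have h3 := hg y hy y' hy'
      have h4 : dist y y' ≤ t x + dist x x' + t x' := by
        rw [← hxy, ← hxy', dist_comm x y]
        exact dist_triangle4 y x x' y'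
      have e : μ x - μ x' = (μ x - g y) + (g y - g y') - (μ x' - g y') := by abel
      calc ‖μ x - μ x'‖ ≤ ‖μ x - g y‖ + ‖g y - g y'‖ + ‖μ x' - g y'‖ := by
            rw [e]
            exact (norm_sub_le _ _).trans (add_le_add_left (norm_add_le _ _) _)
        _ ≤ 200000 * 1 * dist x x' := by
            have := dist_nonneg (x := x) (y := x')
            linarith
        _ ≤ _ := by
            gcongr
            linarith
    · have htx : 0 < t x := by linarith [dist_nonneg (x := x) (y := x')]
      have htx' : 0 < t x' := by
        have : t x ≤ t x' + dist x x' := Metric.infDist_le_infDist_add_dist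
        linarith
      have hx : x ∉ N := fun h => htx.ne' (Metric.infDist_zero_of_mem h)
      have hx' : x' ∉ N := fun h => htx'.ne' (Metric.infDist_zero_of_mem h)
      obtain ⟨B, hBc, hB, hBd⟩ := exists_window hD hsep htx
      have hBx := hB x (by simpa using htx)
      have hBx' := hB x' hclose
      obtain ⟨hm, h1⟩ := hsum x B htx hBx
      obtain ⟨hm', h1'⟩ := hsum x' B htx' hBx'
      have hTV := sum_abs_normalized_pow_sub_le B (weight (N : Set M) S x)
        (weight (N : Set M) S x') a ha1 (fun _ _ => weight_nonneg _ _)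
        (fun _ _ => weight_nonneg _ _) (hBc.trans ha4) hm hm' (η := 8 * dist x x' / t x) (by
          intro z hz
          refine (abs_weight_sub_le x x' z).trans ?_
          rw [div_le_div_iff₀ (by positivity) htx]
          calc dist x x' * t x ≤ dist x x' * (8 * 2 ^ z.1) :=
                mul_le_mul_of_nonneg_left (hBd z hz).2.1 dist_nonneg
            _ = _ := by ring)
      rw [hμN' x hx, hμN' x' hx', average_eq_sum ha0 g hBx, average_eq_sum ha0 g hBx']
      set p := fun z => weight (N : Set M) S x z ^ a / ∑ z' ∈ B, weight (N : Set M) S x z' ^ a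
      set q := fun z => weight (N : Set M) S x' z ^ a / ∑ z' ∈ B, weight (N : Set M) S x' z' ^ a
      -- Both weight vectors have sum `1`, so a constant can be subtracted from the values.
      have e : ∑ z ∈ B, p z • g z.2 - ∑ z ∈ B, q z • g z.2 =
          ∑ z ∈ B, (p z - q z) • (g z.2 - g y) := by
        simp only [smul_sub, sub_smul, Finset.sum_sub_distrib, ← Finset.sum_smul]
        rw [h1, h1']
        abel
      calc ‖∑ z ∈ B, p z • g z.2 - ∑ z ∈ B, q z • g z.2‖
          ≤ ∑ z ∈ B, |p z - q z| * (65 * t x) := by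
            rw [e]
            refine norm_sum_le_of_le _ fun z hz => ?_
            obtain ⟨hzS, -, hzd⟩ := hBd z hz
            rw [norm_smul, Real.norm_eq_abs]
            refine mul_le_mul_of_nonneg_left ((hg _ (hSN _ hzS) y hy).trans ?_) (abs_nonneg _)
            have := dist_triangle_left z.2 y x
            linarith
        _ ≤ 64 * a * (8 * dist x x' / t x) * (65 * t x) := by
            rw [← Finset.sum_mul]
            gcongr
        _ = 33280 * a * dist x x' := by field_simp; ring
        _ ≤ 33280 * (6 * (1 + Real.log D)) * dist x x' := by gcongr
        _ ≤ 200000 * (1 + Real.log D) * dist x x' := by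
            gcongr ?_ * _
            linarith
  · intro x
    by_cases hx : x ∈ N
    · rw [hμN x hx]
      exact Submodule.subset_span ⟨x, hx, rfl⟩
    obtain ⟨B, -, hB, hBd⟩ := exists_window hD hsep (ht0 x hx)
    rw [hμN' x hx, average_eq_sum ha0 g (hB x (by simpa using ht0 x hx))]
    exact Submodule.sum_mem _ fun z hz => Submodule.smul_mem _ _
      (Submodule.subset_span ⟨z.2, hSN _ (hBd z hz).1, rfl⟩)

/-! ### The approximation property -/

theorem corollary2p2 :
    ∃ C : ℝ, 0 < C ∧ ∀ (M : Type*) [MetricSpace M] (o : M) (D : ℝ), IsDoublingConstant M D →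
      HasBAP (LipschitzFree M o) (C * (1 + Real.log D)) := by
  refine ⟨200000, by norm_num, fun M _ o D hD => ?_⟩
  classical
  have hlog : 0 ≤ Real.log D := Real.log_nonneg (hD.one_le o)
  have hl1 : 1 ≤ 200000 * (1 + Real.log D) := by linarith
  have : CompleteSpace (Submodule.span ℝ (Set.range (Lip0.dirac o))).topologicalClosure :=
    inferInstanceAs (CompleteSpace (LipschitzFree M o))
  refine hasBAP_closedSpan (s := Set.range (Lip0.dirac o)) hl1 fun t hts htf => ?_
  obtain ⟨N₀, rfl⟩ : ∃ N₀ : Finset M, Lip0.dirac o '' (N₀ : Set M) = t := by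
    obtain ⟨N₀, -, h⟩ := Finset.subset_set_image_iff.1
      (show (htf.toFinset : Set _) ⊆ Lip0.dirac o '' Set.univ by simpa using hts)
    exact ⟨N₀, by rw [← Finset.coe_image, h, htf.coe_toFinset]⟩
  obtain ⟨μ, hμ, hspan, hμN⟩ := hD.exists_lipschitz_extension (insert o N₀)
    (Finset.insert_nonempty _ _) (Lip0.dirac o) fun y _ y' _ => Lip0.norm_dirac_sub_le y y'
  have hμL : LipschitzWith ⟨200000 * (1 + Real.log D), by linarith⟩ μ :=
    LipschitzWith.of_dist_le_mul fun x y => by rw [dist_eq_norm]; exact hμ x y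
  have hμo : μ o = 0 := (hμN o (Finset.mem_insert_self _ _)).trans Lip0.dirac_base
  set S := Lip0.ofDualMap μ _ hμL hμo
  let A : StrongDual ℝ (Lip0 M o) →L[ℝ] StrongDual ℝ (Lip0 M o) :=
    (ContinuousLinearMap.compL ℝ (Lip0 M o) (Lip0 M o) ℝ).flip S
  -- `A` is the adjoint of `S`, so it sends `δ(x)` to `f ↦ (S f) x = μ x f`.
  have hA : ∀ x, A (Lip0.dirac o x) = μ x := fun x => rfl
  refine ⟨Lip0.dirac o '' (insert o N₀ : Finset M), Set.image_subset_range _ _,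
    Set.image_mono (by simp), (Finset.finite_toSet _).image _, A, ?_, ?_, ?_⟩
  · refine ContinuousLinearMap.opNorm_le_bound _ (by linarith) fun φ => ?_
    rw [mul_comm]
    exact (ContinuousLinearMap.opNorm_comp_le φ S).trans
      (mul_le_mul_of_nonneg_left (Lip0.norm_ofDualMap_le μ _ hμL hμo) (norm_nonneg _))
  · rintro _ ⟨x, rfl⟩
    exact hspan x
  · rintro _ ⟨y, hy, rfl⟩
    rw [hA, hμN y hy]
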